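/- **Theorem 1.2.** A metric space $(X,d)$ is *uniformly locally finite* (u.l.f.) if $\sup_{x\in X}|\{y\in X : d(x,y)\le n\}|<\infty$ for every $n\in\mathbb{N}$. For $p\in[1,\infty)$ let $\mathrm{B}^p_u(X)$ be the $\ell_p$ uniform Roe algebra of $X$, that is, the norm closure in $\mathcal{B}(\ell_p(X))$ (complex scalars) of the algebra of bounded operators $T$ of finite propagation, i.e. those for which there is $r$ such that $(T\delta_x)(y)\neq 0$ implies $d(x,y)\le r$. An operator $a\in \mathrm{B}^p_u(X)$ is a *ghost* if for every $\varepsilon>0$ there is a finite $A\subseteq X$ with $\|e_{yy}\,a\,e_{xx}\|<\varepsilon$ for all $x,y\in X\setminus A$, where $e_{xx}$ is the rank one operator $\xi\mapsto \xi(x)\delta_x$. A subalgebra $B$ of an algebra $A$ is *hereditary* if $BAB\subseteq B$. Let $p\in[1,\infty)$, let $(X,d)$ and $(Y,\partial)$ be u.l.f. metric spaces, and assume that every ghost idempotent in $\mathrm{B}^p_u(Y)$ is compact. Suppose that there is an isomorphic embedding of $\mathrm{B}^p_u(X)$ onto a hereditary Banach subalgebra of $\mathrm{B}^p_u(Y)$,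 that is, a (not necessarily unital) algebra homomorphism $\Phi\colon \mathrm{B}^p_u(X)\to \mathrm{B}^p_u(Y)$ that is bounded and bounded below and whose range is a closed hereditary subalgebra of $\mathrm{B}^p_u(Y)$. Then $X$ coarsely embeds into $Y$: there is a map $f\colon X\to Y$ such that for every $r>0$ there is $s>0$ such that $d(x,x')<r$ implies $\partial(f(x),f(x'))<s$ for all $x,x'\in X$, and for every $s>0$ there is $r>0$ such that $d(x,x')>r$ implies $\partial(f(x),f(x'))>s$ for all $x,x'\in X$. -/

import Mathlib

open scoped ENNReal

noncomputable section

namespace UniformRoe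

/-- A metric space is uniformly locally finite if, for every `n`, the cardinalities of its closed
balls of radius `n` are uniformly bounded. -/
def UniformlyLocallyFinite (X : Type*) [MetricSpace X] : Prop :=
  ∀ n : ℕ, ∃ N : ℕ, ∀ x : X, {y : X | dist x y ≤ n}.encard ≤ N

/-- `f` is coarse: points at bounded distance are sent to points at bounded distance. -/
def IsCoarse {X Y : Type*} [MetricSpace X] [MetricSpace Y] (f : X → Y) : Prop :=
  ∀ r > (0 : ℝ), ∃ s > (0 : ℝ), ∀ x y : X, dist x y < r → dist (f x) (f y) < s

/-- `f` is expanding: points far apart are sent to points far apart. -/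
def IsExpanding {X Y : Type*} [MetricSpace X] [MetricSpace Y] (f : X → Y) : Prop :=
  ∀ s > (0 : ℝ), ∃ r > (0 : ℝ), ∀ x y : X, r < dist x y → s < dist (f x) (f y)

/-- A coarse embedding is a map which is both coarse and expanding. -/
def IsCoarseEmbedding {X Y : Type*} [MetricSpace X] [MetricSpace Y] (f : X → Y) : Prop :=
  IsCoarse f ∧ IsExpanding f

/-- The complex Banach space `ℓ_p(X)`. -/
abbrev Ell (p : ℝ≥0∞) (X : Type*) : Type _ := lp (fun _ : X => ℂ) p

section Operators

variable (p : ℝ≥0∞) {X : Type*}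

/-- The unit vector `δ_x`, the indicator function of `{x}`. -/
def delta (x : X) : Ell p X :=
  letI := Classical.decEq X
  lp.single p x (1 : ℂ)

theorem delta_self (x : X) : (delta p x : Ell p X) x = 1 :=
  letI := Classical.decEq X
  lp.single_apply_self (E := fun _ : X => ℂ) p x 1

theorem delta_of_ne {x y : X} (h : y ≠ x) : (delta p x : Ell p X) y = 0 :=
  letI := Classical.decEq X
  lp.single_apply_ne (E := fun _ : X => ℂ) p x 1 h

variable [Fact (1 ≤ p)]

/-- The evaluation functional `ξ ↦ ξ(x)` on `ℓ_p(X)`. -/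
def coord (x : X) : Ell p X →L[ℂ] ℂ :=
  LinearMap.mkContinuous
    { toFun := fun ξ => ξ x
      map_add' := fun _ _ => rfl
      map_smul' := fun _ _ => rfl } 1
    (fun ξ => (lp.norm_apply_le_norm
      (zero_lt_one.trans_le (Fact.out : 1 ≤ p)).ne' ξ x).trans_eq (one_mul ‖ξ‖).symm)

/-- The matrix unit `e_{xy}`, that is, the operator `ξ ↦ ξ(x) δ_y`; it sends `δ_x` to `δ_y` and the
other unit vectors to `0`. -/
def matrixUnit (x y : X) : Ell p X →L[ℂ] Ell p X :=
  (coord p x).smulRight (delta p y)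

variable {p}

/-- `a` is a ghost: its matrix entries are arbitrarily small off finite sets. -/
def IsGhost (a : Ell p X →L[ℂ] Ell p X) : Prop :=
  ∀ ε > (0 : ℝ), ∃ A : Finset X, ∀ x ∉ A, ∀ y ∉ A,
    ‖matrixUnit p y y * a * matrixUnit p x x‖ < ε

/-- `T` has propagation at most `r`. -/
def HasPropagationLE [MetricSpace X] (T : Ell p X →L[ℂ] Ell p X) (r : ℝ) : Prop :=
  ∀ x y : X, T (delta p x) y ≠ 0 → dist x y ≤ r

theorem HasPropagationLE.add [MetricSpace X] {S T : Ell p X →L[ℂ] Ell p X} {r s : ℝ}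
    (hS : HasPropagationLE S r) (hT : HasPropagationLE T s) :
    HasPropagationLE (S + T) (max r s) := by
  intro x y h
  by_cases hx : S (delta p x) y = 0
  · by_cases hy : T (delta p x) y = 0
    · exact absurd (by simp [hx, hy]) h
    · exact (hT x y hy).trans (le_max_right _ _)
  · exact (hS x y hx).trans (le_max_left _ _)

theorem HasPropagationLE.mul [MetricSpace X] [hp : Fact (p ≠ ∞)]
    {S T : Ell p X →L[ℂ] Ell p X} {r s : ℝ}
    (hS : HasPropagationLE S r) (hT : HasPropagationLE T s) :
    HasPropagationLE (S * T) (r + s) := by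
  classical
  intro x z h
  have h1 := lp.hasSum_single hp.out (T (delta p x))
  have h2 := h1.mapL ((coord p z).comp S)
  by_contra hlt
  apply h
  refine h2.unique ?_
  convert hasSum_zero with y
  have h3 : (lp.single p y (T (delta p x) y) : Ell p X) = T (delta p x) y • delta p y := by
    refine lp.ext (funext fun w => ?_)
    by_cases hw : w = y
    · subst hw
      rw [lp.single_apply_self, lp.coeFn_smul, Pi.smul_apply, delta_self]
      simp
    · rw [lp.single_apply_ne _ _ _ hw, lp.coeFn_smul, Pi.smul_apply, delta_of_ne p hw]
      simp
  rw [h3, map_smul]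
  by_cases hTy : T (delta p x) y = 0
  · simp [hTy]
  · by_cases hSz : S (delta p y) z = 0
    · have : ((coord p z).comp S) (delta p y) = 0 := hSz
      simp [this]
    · exact absurd ((dist_triangle x y z).trans
        (by linarith [hT x y hTy, hS y z hSz])) hlt

end Operators

/-- The algebra of operators of finite propagation on `ℓ_p(X)`, where `1 ≤ p < ∞`. -/
def finitePropagation (p : ℝ≥0∞) [Fact (1 ≤ p)] [Fact (p ≠ ∞)] (X : Type*) [MetricSpace X] :
    Subalgebra ℂ (Ell p X →L[ℂ] Ell p X) where
  carrier := {T | ∃ r : ℝ, HasPropagationLE T r}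
  mul_mem' := fun ⟨_, hS⟩ ⟨_, hT⟩ => ⟨_, hS.mul hT⟩
  add_mem' := fun ⟨_, hS⟩ ⟨_, hT⟩ => ⟨_, hS.add hT⟩
  algebraMap_mem' := fun c => ⟨0, by
    intro x y h
    by_contra hxy
    apply h
    have hne : y ≠ x := by
      rintro rfl
      simp at hxy
    have h0 : (delta p x : Ell p X) y = 0 := delta_of_ne p hne
    simp [Algebra.algebraMap_eq_smul_one, h0]⟩

/-- The `ℓ_p` uniform Roe algebra of `X`: the norm closure of the operators of finite propagation,
with the operator norm. -/
def roeAlgebra (p : ℝ≥0∞) [Fact (1 ≤ p)] [Fact (p ≠ ∞)] (X : Type*) [MetricSpace X] :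
    Subalgebra ℂ (Ell p X →L[ℂ] Ell p X) :=
  (finitePropagation p X).topologicalClosure

/-- A subalgebra `B` of `A` is hereditary if `B A B ⊆ B`. -/
def IsHereditary {A : Type*} [Ring A] [Algebra ℂ A] (B : NonUnitalSubalgebra ℂ A) : Prop :=
  ∀ b ∈ B, ∀ a : A, ∀ b' ∈ B, b * a * b' ∈ B

/-- A (not necessarily unital) algebra homomorphism of normed algebras is an isomorphic embedding
if it is bounded and bounded below, that is, a linear homeomorphism onto its range. -/
def IsIsomorphicEmbedding {A B : Type*} [NormedRing A] [NormedAlgebra ℂ A] [NormedRing B]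
    [NormedAlgebra ℂ B] (Φ : A →ₙₐ[ℂ] B) : Prop :=
  (∃ C > (0 : ℝ), ∀ a : A, ‖Φ a‖ ≤ C * ‖a‖) ∧ (∃ c > (0 : ℝ), ∀ a : A, c * ‖a‖ ≤ ‖Φ a‖)

end UniformRoe

end

noncomputable section

namespace UniformRoe

/-! ### Coordinates and matrix entries on `ℓ_p`. -/

section Basics

variable {p : ℝ≥0∞} {X : Type*}

/-! The embedding is spatial: with `ξ₀` in the range of the image of a rank one idempotent, heredity
yields bounded `U`, `V` with `V U = 1`, `Φ a = U a V`, and `V b U` in the Roe algebra of `X` for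
every `b` in that of `Y` (`exists_spatial_implementation`).

If the entries of `U e_{xx} V` were not uniformly bounded below, infinitely many distinct `x` with
geometrically decaying bounds would give a set `S` for which `U 1_S V` is a noncompact ghost
idempotent (`exists_forall_exists_le_norm_entry_mul`). So each `x` has `f x`, `g x` at which `U δ_x`
and `V δ_{g x}` have large entries.

A Baire category argument makes entries of `U e_{x'x} V` uniformly small far from the diagonal when
`dist x x'` is bounded (`exists_dist_le_of_le_norm_entry_mul`). Applied to `(U, V)` it makes `f`
coarse; applied to `(V, U)` it makes `f` expanding. -/

theorem toReal_pos_of_fact [Fact (1 ≤ p)] [Fact (p ≠ ∞)] : 0 < p.toReal :=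
  ENNReal.toReal_pos (zero_lt_one.trans_le (Fact.out : 1 ≤ p)).ne' (Fact.out : p ≠ ∞)

theorem norm_delta [Fact (1 ≤ p)] (x : X) : ‖delta p x‖ = 1 := by
  classical
  have h := lp.norm_single (E := fun _ : X => ℂ) (zero_lt_one.trans_le (Fact.out : 1 ≤ p)) x (1 : ℂ)
  rw [norm_one] at h
  convert h using 2
  unfold delta
  congr!

theorem delta_apply [DecidableEq X] (x y : X) :
    (delta p x : Ell p X) y = if y = x then 1 else 0 := by
  split_ifs with h
  · rw [h, delta_self]
  · exact delta_of_ne p h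

theorem norm_coe_le [Fact (1 ≤ p)] (ξ : Ell p X) (x : X) : ‖ξ x‖ ≤ ‖ξ‖ :=
  lp.norm_apply_le_norm (zero_lt_one.trans_le (Fact.out : 1 ≤ p)).ne' ξ x

@[simp]
theorem coord_apply [Fact (1 ≤ p)] (x : X) (ξ : Ell p X) : coord p x ξ = ξ x := rfl

theorem hasSum_delta [Fact (1 ≤ p)] [Fact (p ≠ ∞)] (ξ : Ell p X) :
    HasSum (fun x => ξ x • delta p x) ξ := by
  classical
  convert lp.hasSum_single (Fact.out : p ≠ ∞) ξ with x
  refine lp.ext (funext fun w => ?_)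
  by_cases hw : w = x
  · subst hw
    rw [lp.single_apply_self, lp.coeFn_smul, Pi.smul_apply, delta_self]
    simp
  · rw [lp.single_apply_ne _ _ _ hw, lp.coeFn_smul, Pi.smul_apply, delta_of_ne p hw]
    simp

/-- Coordinates of a vector of `ℓ_p`, with `p < ∞`, are small off a finite set. -/
theorem exists_finset_norm_coe_lt [Fact (1 ≤ p)] [Fact (p ≠ ∞)] (ξ : Ell p X) {ε : ℝ}
    (hε : 0 < ε) : ∃ A : Finset X, ∀ x ∉ A, ‖ξ x‖ < ε := by
  have h := (hasSum_delta ξ).summable.tendsto_cofinite_zero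
  have h2 := (h.norm).eventually (gt_mem_nhds (by simpa using hε))
  refine ⟨h2.toFinset, fun x hx => ?_⟩
  have : ‖ξ x • delta p x‖ < ε := by
    by_contra hlt
    exact hx (h2.mem_toFinset.2 hlt)
  simpa [norm_smul, norm_delta] using this

theorem norm_coord_le [Fact (1 ≤ p)] (x : X) : ‖coord p x‖ ≤ 1 :=
  ContinuousLinearMap.opNorm_le_bound _ zero_le_one fun ξ => by
    simpa using norm_coe_le ξ x

theorem norm_matrixUnit_mul_mul_le [Fact (1 ≤ p)] (a : Ell p X →L[ℂ] Ell p X) (x y : X) :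
    ‖matrixUnit p y y * a * matrixUnit p x x‖ ≤ ‖a (delta p x) y‖ := by
  refine ContinuousLinearMap.opNorm_le_bound _ (norm_nonneg _) fun ζ => ?_
  change ‖coord p y (a (coord p x ζ • delta p x)) • delta p y‖ ≤ _
  rw [map_smul, map_smul, norm_smul, norm_smul, norm_delta, mul_one, mul_comm]
  exact mul_le_mul_of_nonneg_left (norm_coe_le ζ x) (norm_nonneg _)

end Basics

/-! ### Operators of bounded propagation and decay off the diagonal. -/

section Composition

variable {p : ℝ≥0∞} [Fact (1 ≤ p)] [Fact (p ≠ ∞)] {X : Type*}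

/-- Each `‖ξ z‖ ^ p` is counted at most once per point of the fibre over `z`. -/
theorem sum_norm_comp_le {t : X → X} {N : ℕ} (ht : ∀ z, {x | t x = z}.encard ≤ N) (S : X → Bool)
    (ξ : Ell p X) (s : Finset X) :
    ∑ x ∈ s, ‖if S x then ξ (t x) else 0‖ ^ p.toReal ≤ N * ‖ξ‖ ^ p.toReal := by
  classical
  have hp : 0 < p.toReal := toReal_pos_of_fact
  calc ∑ x ∈ s, ‖if S x then ξ (t x) else 0‖ ^ p.toReal
      ≤ ∑ x ∈ s, ‖ξ (t x)‖ ^ p.toReal := by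
        refine Finset.sum_le_sum fun x _ => ?_
        split_ifs
        · exact le_rfl
        · rw [norm_zero, Real.zero_rpow hp.ne']
          positivity
    _ = ∑ z ∈ s.image t, (s.filter (fun x => t x = z)).card • ‖ξ z‖ ^ p.toReal :=
        Finset.sum_comp (fun z => ‖ξ z‖ ^ p.toReal) t
    _ ≤ ∑ z ∈ s.image t, N * ‖ξ z‖ ^ p.toReal := by
        refine Finset.sum_le_sum fun z _ => ?_
        rw [nsmul_eq_mul]
        have h1 : ((s.filter (fun x => t x = z) : Finset X) : Set X).encard ≤ N :=
          (Set.encard_le_encard (by intro x; simp)).trans (ht z)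
        rw [Set.encard_coe_eq_coe_finsetCard] at h1
        gcongr
        exact_mod_cast h1
    _ ≤ N * ‖ξ‖ ^ p.toReal := by
        rw [← Finset.mul_sum]
        gcongr
        exact lp.sum_rpow_le_norm_rpow hp ξ _

/-- The operator sending `ξ` to `ξ ∘ t`, cut down to `S`, where the fibres of `t` have at most `N`
points. -/
def cutComp (p : ℝ≥0∞) [Fact (1 ≤ p)] [Fact (p ≠ ∞)] (t : X → X) (N : ℕ)
    (ht : ∀ z, {x | t x = z}.encard ≤ N) (S : X → Bool) : Ell p X →L[ℂ] Ell p X :=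
  LinearMap.mkContinuous
    { toFun := fun ξ => ⟨fun x => if S x then ξ (t x) else 0,
        memℓp_gen' (sum_norm_comp_le ht S ξ)⟩
      map_add' := fun ξ η => lp.ext (funext fun x => by
        change (if S x then (ξ + η) (t x) else 0)
          = (if S x then ξ (t x) else 0) + (if S x then η (t x) else 0)
        split_ifs <;> simp)
      map_smul' := fun c ξ => lp.ext (funext fun x => by
        change (if S x then (c • ξ) (t x) else 0) = c • (if S x then ξ (t x) else 0)
        split_ifs <;> simp) }
    ((N : ℝ) ^ (1 / p.toReal))
    (fun ξ => by
      have hp : 0 < p.toReal := toReal_pos_of_fact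
      refine lp.norm_le_of_forall_sum_le hp (by positivity) fun s => ?_
      rw [Real.mul_rpow (by positivity) (by positivity), ← Real.rpow_mul (by positivity),
        one_div, inv_mul_cancel₀ hp.ne', Real.rpow_one]
      exact sum_norm_comp_le ht S ξ s)

theorem cutComp_apply (t : X → X) (N : ℕ) (ht : ∀ z, {x | t x = z}.encard ≤ N) (S : X → Bool)
    (ξ : Ell p X) (x : X) : cutComp p t N ht S ξ x = if S x then ξ (t x) else 0 := rfl

theorem HasPropagationLE.mem_roeAlgebra [MetricSpace X] {T : Ell p X →L[ℂ] Ell p X} {r : ℝ}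
    (hT : HasPropagationLE T r) : T ∈ roeAlgebra p X :=
  Subalgebra.le_topologicalClosure _ ⟨r, hT⟩

theorem cutComp_mem_roeAlgebra [MetricSpace X] {t : X → X} {N : ℕ}
    (ht : ∀ z, {x | t x = z}.encard ≤ N) (S : X → Bool) {r : ℝ} (hr : ∀ x, dist (t x) x ≤ r) :
    cutComp p t N ht S ∈ roeAlgebra p X := by
  classical
  refine HasPropagationLE.mem_roeAlgebra (r := r) fun x y h => ?_
  rw [cutComp_apply, delta_apply] at h
  have h2 : t y = x := by
    by_contra h3
    simp [h3] at h
  exact h2 ▸ hr y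

/-- Rank one operators with finitely supported functional belong to the uniform Roe algebra. -/
theorem smulRight_coord_mem_roeAlgebra [MetricSpace X] (x : X) (ξ : Ell p X) :
    (coord p x).smulRight ξ ∈ roeAlgebra p X := by
  have h := (hasSum_delta ξ).mapL (ContinuousLinearMap.smulRightL ℂ (Ell p X) (Ell p X) (coord p x))
  refine (Subalgebra.isClosed_topologicalClosure (finitePropagation p X)).mem_of_tendsto h
    (Filter.Eventually.of_forall fun s => ?_)
  refine Subalgebra.sum_mem _ fun y _ => ?_
  rw [map_smul]
  refine Subalgebra.smul_mem _ ?_ _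
  refine HasPropagationLE.mem_roeAlgebra (r := dist x y) fun z w h => ?_
  have h' : (delta p z : Ell p X) x * (delta p y : Ell p X) w ≠ 0 := h
  have h1 : x = z := by
    by_contra h3
    simp [delta_of_ne p h3] at h'
  have h2 : w = y := by
    by_contra h3
    simp [delta_of_ne p h3] at h'
  rw [h1, h2]

/-- The matrix entries of an operator in the uniform Roe algebra are small far from the diagonal. -/
theorem exists_dist_le_of_le_norm_entry [MetricSpace X] {b : Ell p X →L[ℂ] Ell p X}
    (hb : b ∈ roeAlgebra p X) {ε : ℝ} (hε : 0 < ε) :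
    ∃ k : ℕ, ∀ x y, ε ≤ ‖b (delta p x) y‖ → dist x y ≤ k := by
  rw [roeAlgebra, ← SetLike.mem_coe, Subalgebra.topologicalClosure_coe] at hb
  obtain ⟨T, ⟨r, hr⟩, hT⟩ := Metric.mem_closure_iff.1 hb ε hε
  obtain ⟨k, hk⟩ := exists_nat_ge r
  refine ⟨k, fun x y h => (hr x y fun h0 => ?_).trans hk⟩
  have h1 : ‖(b - T) (delta p x) y‖ ≤ ‖b - T‖ :=
    (norm_coe_le _ _).trans (((b - T).le_opNorm _).trans (by simp [norm_delta]))
  rw [dist_eq_norm] at hT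
  have h2 : (b - T) (delta p x) y = b (delta p x) y := by simp [h0]
  rw [h2] at h1
  linarith

end Composition

/-! ### Uniform decay by Baire category. -/

section Spread

variable {p : ℝ≥0∞} [Fact (1 ≤ p)] [Fact (p ≠ ∞)] {X Y : Type*} [MetricSpace X] [MetricSpace Y]

/-- `cutComp` is the sum over `x ∈ S` of the matrix units from `t x` to `x`, so every `S` has its
own propagation bound. Baire category on the compact space `X → Bool` makes the bound uniform on an
open set of `S`, and toggling one point of `S` isolates one matrix unit. -/
theorem exists_dist_le_of_le_norm_entry_mul_comp {U : Ell p X →L[ℂ] Ell p Y}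
    {V : Ell p Y →L[ℂ] Ell p X}
    (hUV : ∀ a ∈ roeAlgebra p X, U ∘L a ∘L V ∈ roeAlgebra p Y)
    {t : X → X} {N : ℕ} (ht : ∀ z, {x | t x = z}.encard ≤ N) {r : ℝ} (hr : ∀ x, dist (t x) x ≤ r)
    {ε : ℝ} (hε : 0 < ε) :
    ∃ k : ℕ, ∀ x y y', ε ≤ ‖U (delta p x) y * V (delta p y') (t x)‖ → dist y' y ≤ k := by
  classical
  have hsum : ∀ (S : X → Bool) (y y' : Y), HasSum
      (fun x => if S x then U (delta p x) y * V (delta p y') (t x) else 0)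
      (U (cutComp p t N ht S (V (delta p y'))) y) := by
    intro S y y'
    have h := (hasSum_delta (cutComp p t N ht S (V (delta p y')))).mapL ((coord p y).comp U)
    convert! h using 2 with x
    · rw [map_smul, cutComp_apply]
      split_ifs <;> simp [mul_comm]
  set F : ℕ → Set (X → Bool) := fun k =>
    {S | ∀ y y', (k : ℝ) < dist y' y → ‖U (cutComp p t N ht S (V (delta p y'))) y‖ ≤ ε / 3} with hF
  have hclosed : ∀ k, IsClosed (F k) := by
    intro k
    simp only [hF, Set.ofPred_forall]
    refine isClosed_iInter fun y => isClosed_iInter fun y' => isClosed_iInter fun _ => ?_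
    refine isClosed_le (Continuous.norm ?_) continuous_const
    simp_rw [fun S => (hsum S y y').tsum_eq.symm]
    -- The series over all of `X` dominates absolutely and uniformly in `S`.
    refine continuous_tsum (u := fun x => ‖U (delta p x) y * V (delta p y') (t x)‖)
      (fun x => ?_) ?_ fun x S => ?_
    · exact (continuous_of_discreteTopology (f := fun b : Bool =>
        if b then U (delta p x) y * V (delta p y') (t x) else 0)).comp (continuous_apply x)
    · simpa using (hsum (fun _ => true) y y').summable.norm
    · split_ifs
      · exact le_rfl
      · rw [norm_zero]
        positivity
  have hcover : ⋃ k, F k = Set.univ := by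
    refine Set.eq_univ_of_forall fun S => Set.mem_iUnion.2 ?_
    obtain ⟨k, hk⟩ := exists_dist_le_of_le_norm_entry
      (hUV _ (cutComp_mem_roeAlgebra ht S hr)) (show 0 < ε / 3 by positivity)
    refine ⟨k, fun y y' h => ?_⟩
    by_contra! h2
    exact absurd (hk y' y h2.le) (not_le.2 h)
  obtain ⟨k, S₀, hS₀⟩ := nonempty_interior_of_iUnion_of_closed hclosed hcover
  obtain ⟨I, u, hu, hIu⟩ := isOpen_pi_iff.1 isOpen_interior S₀ hS₀
  have hmem : ∀ S : X → Bool, (∀ x ∈ I, S x = S₀ x) → S ∈ F k := fun S hS =>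
    interior_subset (hIu fun x hx => by rw [hS x hx]; exact (hu x hx).2)
  -- Membership in the open set fixes `S` on the finite set `I`; points of `I` are treated one by
  -- one through rank one operators.
  have hpt : ∀ x, ∃ m : ℕ, ∀ y y', ε ≤ ‖U (delta p x) y * V (delta p y') (t x)‖ →
      dist y' y ≤ m := by
    intro x
    obtain ⟨m, hm⟩ := exists_dist_le_of_le_norm_entry
      (hUV _ (smulRight_coord_mem_roeAlgebra (t x) (delta p x))) hε
    refine ⟨m, fun y y' h => hm y' y (h.trans_eq ?_)⟩
    simp [mul_comm]
  choose m hm using hpt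
  refine ⟨max k (I.sup m), fun x y y' h => ?_⟩
  by_cases hx : x ∈ I
  · refine (hm x y y' h).trans ?_
    exact_mod_cast (Finset.le_sup (f := m) hx).trans (le_max_right _ _)
  · refine le_trans ?_ (Nat.cast_le.2 (le_max_left k (I.sup m)))
    by_contra! hlt
    -- The sums for `S₀` with `x` included and excluded differ by exactly the term at `x`, which is
    -- thus at most `2ε/3`.
    have hval : ∀ b : Bool, Function.update S₀ x b ∈ F k := fun b =>
      hmem _ fun z hz => Function.update_of_ne (ne_of_mem_of_not_mem hz hx) _ _
    have h1 := hval true y y' hlt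
    have h0 := hval false y y' hlt
    have hd := (hsum (Function.update S₀ x true) y y').sub (hsum (Function.update S₀ x false) y y')
    have hs := hasSum_single (f := fun z =>
      (if Function.update S₀ x true z then U (delta p z) y * V (delta p y') (t z) else 0)
      - (if Function.update S₀ x false z then U (delta p z) y * V (delta p y') (t z) else 0)) x
      (fun z hz => by simp [Function.update_of_ne hz])
    have he := hd.unique hs
    simp only [Function.update_self, if_true, Bool.false_eq_true, if_false, sub_zero] at he
    rw [← he] at h
    have := norm_sub_le (U (cutComp p t N ht (Function.update S₀ x true) (V (delta p y'))) y)
      (U (cutComp p t N ht (Function.update S₀ x false) (V (delta p y'))) y)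
    linarith

theorem UniformlyLocallyFinite.exists_encard_le (hX : UniformlyLocallyFinite X) (r : ℝ) :
    ∃ N : ℕ, ∀ x : X, {y : X | dist x y ≤ r}.encard ≤ N := by
  obtain ⟨n, hn⟩ := exists_nat_ge r
  obtain ⟨N, hN⟩ := hX n
  exact ⟨N, fun x => (Set.encard_le_encard fun y (hy : dist x y ≤ r) => hy.trans hn).trans (hN x)⟩

/-- If `a ↦ U a V` maps one uniform Roe algebra into another, then it maps matrix units of bounded
propagation to operators whose entries are uniformly small far from the diagonal. -/
theorem exists_dist_le_of_le_norm_entry_mul (hX : UniformlyLocallyFinite X)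
    {U : Ell p X →L[ℂ] Ell p Y} {V : Ell p Y →L[ℂ] Ell p X}
    (hUV : ∀ a ∈ roeAlgebra p X, U ∘L a ∘L V ∈ roeAlgebra p Y) (r : ℝ)
    {ε : ℝ} (hε : 0 < ε) :
    ∃ k : ℕ, ∀ x x', dist x x' ≤ r → ∀ y y',
      ε ≤ ‖U (delta p x) y * V (delta p y') x'‖ → dist y' y ≤ k := by
  classical
  rcases lt_or_ge r 0 with hr0 | hr0
  · exact ⟨0, fun x x' h => absurd (dist_nonneg.trans h) (not_le.2 hr0)⟩
  obtain ⟨N, hN⟩ := hX.exists_encard_le r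
  have hpt : ∀ x x' : X, ∃ m : ℕ, ∀ y y', ε ≤ ‖U (delta p x) y * V (delta p y') x'‖ →
      dist y' y ≤ m := by
    intro x x'
    obtain ⟨m, hm⟩ := exists_dist_le_of_le_norm_entry
      (hUV _ (smulRight_coord_mem_roeAlgebra x' (delta p x))) hε
    refine ⟨m, fun y y' h => hm y' y (h.trans_eq ?_)⟩
    simp [mul_comm]
  have hfin : ∀ x : X, {y : X | dist x y ≤ r}.Finite := fun x =>
    Set.finite_of_encard_le_coe (hN x)
  -- Pick the worst partner of `x` in its finite ball, measured by the least admissible bound;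
  -- controlling the pairs `(x, t x)` then controls all pairs.
  have hmax : ∀ x : X, ∃ x', dist x x' ≤ r ∧ ∀ x'', dist x x'' ≤ r →
      Nat.find (hpt x x'') ≤ Nat.find (hpt x x') := by
    intro x
    obtain ⟨x', h1, h2⟩ := (hfin x).toFinset.exists_max_image (fun x' => Nat.find (hpt x x'))
      ⟨x, by simpa using hr0⟩
    exact ⟨x', by simpa using h1, fun x'' h => h2 x'' (by simpa using h)⟩
  choose t ht hmt using hmax
  obtain ⟨k, hk⟩ := exists_dist_le_of_le_norm_entry_mul_comp hUV (t := t) (N := N)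
    (fun z => (Set.encard_le_encard fun x (hx : t x = z) => by
      have := ht x
      rw [hx, dist_comm] at this
      exact this).trans (hN z)) (r := r) (fun x => by rw [dist_comm]; exact ht x) hε
  refine ⟨k, fun x x' hxx y y' h => (Nat.find_spec (hpt x x') y y' h).trans ?_⟩
  exact_mod_cast (hmt x x' hxx).trans (Nat.find_min' (hpt x (t x)) (hk x))

end Spread

end UniformRoe

end

noncomputable section

namespace UniformRoe

/-! ### Spatial implementation of the embedding. -/

section Spatial

variable {p : ℝ≥0∞} [Fact (1 ≤ p)] [Fact (p ≠ ∞)] {X Y : Type*} [MetricSpace X] [MetricSpace Y]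

/-- The rank one operator `η ↦ η(x) ξ`, as an element of the uniform Roe algebra. -/
def rankOne (x : X) (ξ : Ell p X) : roeAlgebra p X :=
  ⟨(coord p x).smulRight ξ, smulRight_coord_mem_roeAlgebra x ξ⟩

theorem rankOne_apply (x : X) (ξ η : Ell p X) :
    (rankOne x ξ : Ell p X →L[ℂ] Ell p X) η = η x • ξ := rfl

theorem mul_rankOne (a : roeAlgebra p X) (x : X) (ξ : Ell p X) :
    a * rankOne x ξ = rankOne x ((a : Ell p X →L[ℂ] Ell p X) ξ) := by
  refine Subtype.ext (ContinuousLinearMap.ext fun η => ?_)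
  change (a : Ell p X →L[ℂ] Ell p X) (η x • ξ) = η x • (a : Ell p X →L[ℂ] Ell p X) ξ
  rw [map_smul]

theorem rankOne_add (x : X) (ξ η : Ell p X) : rankOne x (ξ + η) = rankOne x ξ + rankOne x η :=
  Subtype.ext (ContinuousLinearMap.ext fun ζ => smul_add (ζ x) ξ η)

theorem rankOne_smul (x : X) (c : ℂ) (ξ : Ell p X) : rankOne x (c • ξ) = c • rankOne x ξ :=
  Subtype.ext (ContinuousLinearMap.ext fun ζ => smul_comm (ζ x) c ξ)

theorem norm_rankOne_le (x : X) (ξ : Ell p X) : ‖rankOne x ξ‖ ≤ ‖ξ‖ := by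
  change ‖(coord p x).smulRight ξ‖ ≤ ‖ξ‖
  rw [ContinuousLinearMap.norm_smulRight_apply]
  exact mul_le_of_le_one_left (norm_nonneg _) (norm_coord_le x)

theorem norm_mul_mul_le_of_norm_le {A : Type*} [NormedRing A] (a : A) {b : A} {k : ℝ}
    (hb : ‖b‖ ≤ k) (c : A) : ‖a * b * c‖ ≤ ‖a‖ * k * ‖c‖ :=
  (norm_mul_le _ _).trans (mul_le_mul_of_nonneg_right
    ((norm_mul_le _ _).trans (mul_le_mul_of_nonneg_left hb (norm_nonneg _))) (norm_nonneg _))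

set_option maxHeartbeats 1000000 in
/-- An isomorphic embedding of uniform Roe algebras with hereditary range is spatially
implemented. -/
theorem exists_spatial_implementation [Nonempty X] (B : NonUnitalSubalgebra ℂ (roeAlgebra p Y))
    (Φ : roeAlgebra p X →ₙₐ[ℂ] roeAlgebra p Y) (hB : IsHereditary B)
    (hΦ : IsIsomorphicEmbedding Φ) (hrange : Set.range Φ = (B : Set (roeAlgebra p Y))) :
    ∃ (U : Ell p X →L[ℂ] Ell p Y) (V : Ell p Y →L[ℂ] Ell p X),
      V ∘L U = ContinuousLinearMap.id ℂ (Ell p X) ∧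
      (∀ a ∈ roeAlgebra p X, U ∘L a ∘L V ∈ roeAlgebra p Y) ∧
      (∀ b ∈ roeAlgebra p Y, V ∘L b ∘L U ∈ roeAlgebra p X) := by
  obtain ⟨⟨C, hC0, hC⟩, c, hc0, hc⟩ := hΦ
  have hinj : Function.Injective Φ := by
    refine (injective_iff_map_eq_zero Φ).2 fun a ha => ?_
    have h := hc a
    rw [ha, norm_zero] at h
    exact norm_le_zero_iff.1 (nonpos_of_mul_nonpos_right h hc0)
  have hher : ∀ a b a', ∃ t, Φ t = Φ a * b * Φ a' := by
    intro a b a'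
    have hmem : ∀ a, Φ a ∈ B := fun a => by
      rw [← SetLike.mem_coe, ← hrange]
      exact ⟨a, rfl⟩
    have h := hB _ (hmem a) b _ (hmem a')
    rw [← SetLike.mem_coe, ← hrange] at h
    exact h
  obtain ⟨x₀⟩ := ‹Nonempty X›
  set q : roeAlgebra p Y := Φ (rankOne x₀ (delta p x₀)) with hq
  have hqq : q * q = q := by
    rw [hq, ← map_mul, mul_rankOne, rankOne_apply, delta_self, one_smul]
  have hq0 : (q : Ell p Y →L[ℂ] Ell p Y) ≠ 0 := by
    intro h
    have h1 : q = 0 := Subtype.ext h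
    have h2 := hinj (h1.trans (map_zero Φ).symm)
    have h3 := congrArg (fun a : roeAlgebra p X =>
      (a : Ell p X →L[ℂ] Ell p X) (delta p x₀) x₀) h2
    simp [rankOne_apply, delta_self] at h3
  -- With this normalisation `rankOne y₀ ζ` sends `q w` to `ζ`.
  obtain ⟨w, y₀, hw⟩ : ∃ w y₀, (q : Ell p Y →L[ℂ] Ell p Y) w y₀ = 1 := by
    obtain ⟨w, hw⟩ := DFunLike.ne_iff.1 hq0
    obtain ⟨y₀, hy⟩ : ∃ y₀, (q : Ell p Y →L[ℂ] Ell p Y) w y₀ ≠ 0 := by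
      by_contra! h
      exact hw (lp.ext (funext h))
    refine ⟨((q : Ell p Y →L[ℂ] Ell p Y) w y₀)⁻¹ • w, y₀, ?_⟩
    rw [map_smul]
    exact inv_mul_cancel₀ hy
  set ξ₀ : Ell p Y := (q : Ell p Y →L[ℂ] Ell p Y) w with hξ₀
  have hqξ₀ : (q : Ell p Y →L[ℂ] Ell p Y) ξ₀ = ξ₀ := by
    rw [hξ₀]
    exact congrArg (fun a : roeAlgebra p Y => (a : Ell p Y →L[ℂ] Ell p Y) w) hqq
  choose t ht using fun ζ : Ell p Y => hher 1 (rankOne y₀ ζ) (rankOne x₀ (delta p x₀))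
  rw [← hq] at ht
  -- Since `q` is idempotent, `t ζ` absorbs the rank one idempotent at `x₀` on the right, so one
  -- column determines it.
  have ht_rank : ∀ ζ, t ζ = rankOne x₀ ((t ζ : Ell p X →L[ℂ] Ell p X) (delta p x₀)) := by
    intro ζ
    rw [← mul_rankOne]
    apply hinj
    rw [map_mul, ht, ← hq, mul_assoc _ q q, hqq]
  -- The lower bound on `Φ` is what makes `V` bounded.
  have ht_norm : ∀ ζ, ‖t ζ‖ ≤ c⁻¹ * (‖Φ 1‖ * ‖q‖) * ‖ζ‖ := by
    intro ζ
    have h1 : c * ‖t ζ‖ ≤ ‖Φ 1‖ * ‖ζ‖ * ‖q‖ := by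
      refine (hc _).trans ?_
      rw [ht]
      exact norm_mul_mul_le_of_norm_le _ (norm_rankOne_le y₀ ζ) _
    rw [mul_assoc, le_inv_mul_iff₀ hc0]
    linarith
  let U : Ell p X →L[ℂ] Ell p Y := LinearMap.mkContinuous
    { toFun := fun η => (Φ (rankOne x₀ η) : Ell p Y →L[ℂ] Ell p Y) ξ₀
      map_add' := fun η η' => by rw [rankOne_add, map_add]; rfl
      map_smul' := fun k η => by rw [rankOne_smul, map_smul]; rfl } (C * ‖ξ₀‖)
    (fun η => by
      refine (ContinuousLinearMap.le_opNorm _ _).trans ?_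
      rw [mul_right_comm]
      gcongr
      refine (hC _).trans ?_
      gcongr
      exact norm_rankOne_le _ _)
  let V : Ell p Y →L[ℂ] Ell p X := LinearMap.mkContinuous
    { toFun := fun ζ => (t ζ : Ell p X →L[ℂ] Ell p X) (delta p x₀)
      map_add' := fun ζ ζ' => by
        have : t (ζ + ζ') = t ζ + t ζ' := hinj (by
          rw [map_add, ht, ht, ht, rankOne_add, mul_add, add_mul])
        rw [this]; rfl
      map_smul' := fun k ζ => by
        have : t (k • ζ) = k • t ζ := hinj (by
          rw [map_smul, ht, ht, rankOne_smul, mul_smul_comm, smul_mul_assoc])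
        rw [this]; rfl } (c⁻¹ * (‖Φ 1‖ * ‖q‖))
    (fun ζ => by
      refine (ContinuousLinearMap.le_opNorm _ _).trans ?_
      rw [norm_delta, mul_one]
      exact ht_norm ζ)
  have hU : ∀ η, U η = (Φ (rankOne x₀ η) : Ell p Y →L[ℂ] Ell p Y) ξ₀ := fun _ => rfl
  have hV : ∀ ζ, V ζ = (t ζ : Ell p X →L[ℂ] Ell p X) (delta p x₀) := fun _ => rfl
  have hUV : ∀ ζ, U (V ζ) = (Φ 1 : Ell p Y →L[ℂ] Ell p Y) ζ := by
    intro ζ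
    rw [hU, hV, ← ht_rank, ht]
    change (Φ 1 : Ell p Y →L[ℂ] Ell p Y)
      ((rankOne y₀ ζ : Ell p Y →L[ℂ] Ell p Y) ((q : Ell p Y →L[ℂ] Ell p Y) ξ₀)) = _
    rw [hqξ₀, rankOne_apply, hw, one_smul]
  have hΦU : ∀ (a : roeAlgebra p X) η, (Φ a : Ell p Y →L[ℂ] Ell p Y) (U η) =
      U ((a : Ell p X →L[ℂ] Ell p X) η) := by
    intro a η
    rw [hU, hU, ← mul_rankOne, map_mul]
    rfl
  -- `Φ a = Φ a * Φ 1`, `Φ 1 = U V`, and `Φ a` intertwines with `a` through `U`.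
  have hΦ_eq : ∀ a : roeAlgebra p X,
      (Φ a : Ell p Y →L[ℂ] Ell p Y) = U ∘L (a : Ell p X →L[ℂ] Ell p X) ∘L V := by
    intro a
    ext1 ζ
    change _ = U ((a : Ell p X →L[ℂ] Ell p X) (V ζ))
    rw [← hΦU, hUV]
    conv_lhs => rw [← mul_one a, map_mul]
    rfl
  have hU0 : ∀ η, U η = 0 → η = 0 := by
    intro η h
    have h1 : Φ (rankOne x₀ η) = 0 := by
      refine Subtype.ext ?_
      rw [hΦ_eq]
      ext1 ζ
      change U (V ζ x₀ • η) = 0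
      rw [map_smul, h, smul_zero]
    have h2 := hinj (h1.trans (map_zero Φ).symm)
    have h3 : (rankOne x₀ η : Ell p X →L[ℂ] Ell p X) (delta p x₀) = 0 := by rw [h2]; rfl
    rwa [rankOne_apply, delta_self, one_smul] at h3
  have hVU : V ∘L U = ContinuousLinearMap.id ℂ (Ell p X) := by
    ext1 η
    refine sub_eq_zero.1 (hU0 _ ?_)
    change U (V (U η) - η) = 0
    rw [map_sub, hUV, hΦU, sub_eq_zero]
    rfl
  refine ⟨U, V, hVU, fun a ha => ?_, fun b hb => ?_⟩
  · rw [← hΦ_eq ⟨a, ha⟩]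
    exact (Φ ⟨a, ha⟩).2
  -- Heredity puts `Φ 1 * b * Φ 1` in the range, say as `U s V`; compressing by `V` and `U` gives `V
  -- b U = s`.
  · obtain ⟨s, hs⟩ := hher 1 ⟨b, hb⟩ 1
    have hs' := congrArg (fun a : roeAlgebra p Y => (a : Ell p Y →L[ℂ] Ell p Y)) hs
    simp only [hΦ_eq] at hs'
    convert s.2
    ext1 η
    have hVU' : ∀ η, V (U η) = η := fun η => congrArg (fun T : Ell p X →L[ℂ] Ell p X => T η) hVU
    have h := congrArg (fun T : Ell p Y →L[ℂ] Ell p Y => V (T (U η))) hs'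
    change V (U ((s : Ell p X →L[ℂ] Ell p X) (V (U η)))) =
      V ((Φ 1 : Ell p Y →L[ℂ] Ell p Y) (b ((Φ 1 : Ell p Y →L[ℂ] Ell p Y) (U η)))) at h
    rw [← hUV, ← hUV, hVU', hVU', hVU'] at h
    exact h.symm

end Spatial

/-! ### Ghost idempotents and lower bounds on entries. -/

section Ghost

variable {p : ℝ≥0∞} [Fact (1 ≤ p)] [Fact (p ≠ ∞)] {X Y : Type*}

/-- The projection of `ℓ_p` onto the vectors supported on `S`. -/
def cut (p : ℝ≥0∞) [Fact (1 ≤ p)] [Fact (p ≠ ∞)] (S : X → Bool) : Ell p X →L[ℂ] Ell p X :=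
  cutComp p id 1 (fun z => by simp) S

theorem cut_apply (S : X → Bool) (ξ : Ell p X) (x : X) :
    cut p S ξ x = if S x then ξ x else 0 := rfl

theorem cut_mem_roeAlgebra [MetricSpace X] (S : X → Bool) : cut p S ∈ roeAlgebra p X :=
  cutComp_mem_roeAlgebra _ S (r := 0) fun x => by simp

theorem cut_mul_cut (S : X → Bool) : cut p S * cut p S = cut p S := by
  ext ξ x
  change cut p S (cut p S ξ) x = _
  simp only [cut_apply]
  split_ifs <;> rfl

/-- The fixed unit vectors `δ_{z n}` are at mutual distance at least `1`, so no subsequence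
converges. -/
theorem not_isCompactOperator_cut {S : X → Bool} {z : ℕ → X} (hz : Function.Injective z)
    (hS : ∀ n, S (z n) = true) : ¬ IsCompactOperator (cut p S) := by
  intro h
  obtain ⟨K, hK, hKs⟩ := h.image_closedBall_subset_compact (𝕜₁ := ℂ) (f := (cut p S).toLinearMap) 1
  have hfix : ∀ n, cut p S (delta p (z n)) = delta p (z n) := by
    intro n
    refine lp.ext (funext fun x => ?_)
    rw [cut_apply]
    split_ifs with h1
    · rfl
    · rw [delta_of_ne]
      rintro rfl
      exact h1 (hS n)
  obtain ⟨a, -, φ, hφ, hlim⟩ := hK.tendsto_subseq (x := fun n => delta p (z n)) fun n =>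
    hKs ⟨delta p (z n), by simp [norm_delta], hfix n⟩
  obtain ⟨N, hN⟩ := Metric.cauchySeq_iff'.1 hlim.cauchySeq 1 one_pos
  have h1 := hN (N + 1) (Nat.le_succ N)
  rw [dist_eq_norm] at h1
  have h2 := norm_coe_le (((fun n => delta p (z n)) ∘ φ) (N + 1)
    - ((fun n => delta p (z n)) ∘ φ) N) (z (φ (N + 1)))
  rw [lp.coeFn_sub, Pi.sub_apply] at h2
  simp only [Function.comp_apply] at h1 h2
  rw [delta_self, delta_of_ne, sub_zero, norm_one] at h2
  · linarith
  · exact fun h => (hφ (Nat.lt_succ_self N)).ne' (hz h)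

theorem hasSum_cut_entry (U : Ell p X →L[ℂ] Ell p Y) (V : Ell p Y →L[ℂ] Ell p X) (S : X → Bool)
    (y y' : Y) :
    HasSum (fun x => if S x then U (delta p x) y * V (delta p y') x else 0)
      ((U ∘L cut p S ∘L V) (delta p y') y) := by
  have h := (hasSum_delta (cut p S (V (delta p y')))).mapL ((coord p y).comp U)
  convert! h using 2 with x
  rw [map_smul, cut_apply]
  split_ifs <;> simp [mul_comm]

/-- A sum of rank one operators whose entries are dominated by a summable sequence is a ghost. -/
theorem isGhost_comp_cut_comp (U : Ell p X →L[ℂ] Ell p Y) (V : Ell p Y →L[ℂ] Ell p X)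
    {z : ℕ → X} (hz : Function.Injective z) {S : X → Bool}
    (hS : ∀ x, S x = true ↔ x ∈ Set.range z) {m : ℕ → ℝ} (hm : Summable m)
    (hmz : ∀ n y y', ‖U (delta p (z n)) y * V (delta p y') (z n)‖ ≤ m n) :
    IsGhost (U ∘L cut p S ∘L V) := by
  classical
  intro ε hε
  have hsum : ∀ y y', HasSum (fun n => U (delta p (z n)) y * V (delta p y') (z n))
      ((U ∘L cut p S ∘L V) (delta p y') y) := by
    intro y y'
    have h := (hz.hasSum_iff (fun x hx => if_neg fun h => hx ((hS x).1 h))).2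
      (hasSum_cut_entry U V S y y')
    convert! h using 2 with n
    exact (if_pos ((hS _).2 ⟨n, rfl⟩)).symm
  obtain ⟨N, hN⟩ := ((tendsto_sum_nat_add m).eventually
    (gt_mem_nhds (show 0 < ε / 2 by positivity))).exists
  -- The first `N` terms then contribute at most `ε / 2` in total, and the tail less than `ε / 2`.
  -- Only the row index `y` has to avoid a finite set.
  have hε' : 0 < ε / (2 * (N + 1) * (‖V‖ + 1)) := by positivity
  choose A hA using fun n => exists_finset_norm_coe_lt (U (delta p (z n))) hε'
  refine ⟨(Finset.range N).biUnion A, fun y' _ y hy =>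
    (norm_matrixUnit_mul_mul_le _ _ _).trans_lt ?_⟩
  have hyA : ∀ n < N, y ∉ A n := fun n hn h =>
    hy (Finset.mem_biUnion.2 ⟨n, Finset.mem_range.2 hn, h⟩)
  have hs := hsum y y'
  rw [← hs.tsum_eq, ← hs.summable.sum_add_tsum_nat_add N]
  have h1 : ‖∑ n ∈ Finset.range N, U (delta p (z n)) y * V (delta p y') (z n)‖ ≤
      ∑ n ∈ Finset.range N, ε / (2 * (N + 1)) := by
    refine norm_sum_le_of_le _ fun n hn => ?_
    rw [norm_mul]
    have hU := (hA n y (hyA n (Finset.mem_range.1 hn))).le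
    have hV : ‖V (delta p y') (z n)‖ ≤ ‖V‖ + 1 := by
      have h2 := V.le_opNorm (delta p y')
      rw [norm_delta, mul_one] at h2
      linarith [norm_coe_le (V (delta p y')) (z n)]
    refine (mul_le_mul hU hV (norm_nonneg _) hε'.le).trans_eq ?_
    field_simp
  have h2 : ‖∑' n, U (delta p (z (n + N))) y * V (delta p y') (z (n + N))‖ ≤
      ∑' n, m (n + N) :=
    tsum_of_norm_bounded ((summable_nat_add_iff N).2 hm).hasSum fun n => hmz (n + N) y y'
  have h3 : ∑ n ∈ Finset.range N, ε / (2 * (N + 1)) ≤ ε / 2 := by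
    rw [Finset.sum_const, Finset.card_range, nsmul_eq_mul, mul_div_assoc', div_le_div_iff₀
      (by positivity) (by positivity)]
    nlinarith
  refine (norm_add_le _ _).trans_lt ?_
  linarith

/-- If all ghost idempotents are compact, the rank one operators `U e_{xx} V` have matrix entries
uniformly bounded below. -/
theorem exists_forall_exists_le_norm_entry_mul [MetricSpace X] [MetricSpace Y]
    (hghost : ∀ P : roeAlgebra p Y, IsIdempotentElem P →
      IsGhost (P : Ell p Y →L[ℂ] Ell p Y) → IsCompactOperator (P : Ell p Y →L[ℂ] Ell p Y))
    {U : Ell p X →L[ℂ] Ell p Y} {V : Ell p Y →L[ℂ] Ell p X}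
    (hVU : V ∘L U = ContinuousLinearMap.id ℂ (Ell p X))
    (hUV : ∀ a ∈ roeAlgebra p X, U ∘L a ∘L V ∈ roeAlgebra p Y) :
    ∃ δ > (0 : ℝ), ∀ x, ∃ y y', δ ≤ ‖U (delta p x) y * V (delta p y') x‖ := by
  classical
  by_contra! hcon
  have hVU' : ∀ η, V (U η) = η := fun η => congrArg (fun T : Ell p X →L[ℂ] Ell p X => T η) hVU
  -- The diagonal entries of `U e_{xx} V` sum to `(V U δ_x)(x) = 1`.
  have hne : ∀ x, ∃ y, 0 < ‖U (delta p x) y * V (delta p y) x‖ := by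
    intro x
    by_contra! h
    have h1 := (hasSum_delta (U (delta p x))).mapL ((coord p x).comp V)
    have h2 : ∀ y, ((coord p x).comp V) (U (delta p x) y • delta p y) = 0 := fun y => by
      rw [map_smul]
      exact norm_le_zero_iff.1 (h y)
    simp_rw [h2] at h1
    have h3 := h1.unique hasSum_zero
    simp [hVU', delta_self] at h3
  choose w hw using hne
  obtain ⟨g, hg, hgr⟩ := exists_seq_of_forall_finset_exists
    (fun u : ℕ × X => ∀ y y', ‖U (delta p u.2) y * V (delta p y') u.2‖ ≤ (1 / 2) ^ u.1)
    (fun u v => u.1 < v.1 ∧ u.2 ≠ v.2) (fun s _ => by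
      obtain ⟨k, hk⟩ : ∃ k : ℕ, ∀ u ∈ s, u.1 < k :=
        ⟨s.sup (fun u => u.1) + 1, fun u hu => Nat.lt_succ_of_le (Finset.le_sup (f := fun u => u.1) hu)⟩
      obtain ⟨δ, hδ, hδs⟩ : ∃ δ > (0 : ℝ), ∀ u ∈ s,
          δ ≤ ‖U (delta p u.2) (w u.2) * V (delta p (w u.2)) u.2‖ := by
        rcases s.eq_empty_or_nonempty with rfl | hs
        · exact ⟨1, one_pos, by simp⟩
        · obtain ⟨u, -, hu⟩ := s.exists_min_image
            (fun u => ‖U (delta p u.2) (w u.2) * V (delta p (w u.2)) u.2‖) hs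
          exact ⟨_, hw u.2, hu⟩
      -- The power gives summability; `δ` lies below a fixed entry of every earlier point, which
      -- forces `x` to be new.
      obtain ⟨x, hx⟩ := hcon (min δ ((1 / 2) ^ k)) (by positivity)
      refine ⟨(k, x), fun y y' => (hx y y').le.trans (min_le_right _ _), fun u hu =>
        ⟨hk u hu, fun h => ?_⟩⟩
      have h1 := (hx (w x) (w x)).trans_le (min_le_left _ _)
      have h2 := hδs u hu
      rw [h] at h2
      exact absurd h2 (not_le.2 h1))
  have hmono : StrictMono fun n => (g n).1 := fun a b h => (hgr a b h).1
  have hz : Function.Injective fun n => (g n).2 := by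
    intro a b h
    rcases lt_trichotomy a b with hab | hab | hab
    · exact absurd h (hgr a b hab).2
    · exact hab
    · exact absurd h.symm (hgr b a hab).2
  set S : X → Bool := fun x => decide (x ∈ Set.range fun n => (g n).2) with hS
  have hghostS : IsGhost (U ∘L cut p S ∘L V) :=
    isGhost_comp_cut_comp U V hz (by simp [hS]) summable_geometric_two fun n y y' =>
      (hg n y y').trans (pow_le_pow_of_le_one (by norm_num) (by norm_num) (hmono.id_le n))
  have hcpt := hghost ⟨U ∘L cut p S ∘L V, hUV _ (cut_mem_roeAlgebra S)⟩ (by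
    refine Subtype.ext (ContinuousLinearMap.ext fun ζ => ?_)
    change U (cut p S (V (U (cut p S (V ζ))))) = U (cut p S (V ζ))
    rw [hVU']
    exact congrArg (fun T : Ell p X →L[ℂ] Ell p X => U (T (V ζ))) (cut_mul_cut S)) hghostS
  refine not_isCompactOperator_cut (p := p) (S := S) hz (fun n => by simp [hS]) ?_
  -- Compressing by `V` and `U` recovers `cut p S`, which would then be compact.
  have h := (hcpt.comp_clm U).clm_comp V
  have heq : (cut p S : Ell p X → Ell p X) = V ∘ (U ∘L cut p S ∘L V) ∘ U := by
    funext ξ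
    change cut p S ξ = V (U (cut p S (V (U ξ))))
    rw [hVU', hVU']
  rw [heq]
  exact h

end Ghost

end UniformRoe

end

/-! ### The coarse embedding. -/

namespace UniformRoe

/-- A large product has both factors large, as each is at most `K`. Hence the factors for different
points `x`, `x'` can be recombined, and `f x` is near `g x'` whenever `x` is near `x'`. -/
theorem exists_isCoarseEmbedding {p : ℝ≥0∞} [Fact (1 ≤ p)] [Fact (p ≠ ∞)]
    {X Y : Type*} [MetricSpace X] [MetricSpace Y]
    (hX : UniformlyLocallyFinite X) (hY : UniformlyLocallyFinite Y)
    {U : Ell p X →L[ℂ] Ell p Y} {V : Ell p Y →L[ℂ] Ell p X}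
    (hUV : ∀ a ∈ roeAlgebra p X, U ∘L a ∘L V ∈ roeAlgebra p Y)
    (hVU : ∀ b ∈ roeAlgebra p Y, V ∘L b ∘L U ∈ roeAlgebra p X)
    {δ : ℝ} (hδ : 0 < δ) (h : ∀ x, ∃ y y', δ ≤ ‖U (delta p x) y * V (delta p y') x‖) :
    ∃ f : X → Y, IsCoarseEmbedding f := by
  choose f g hfg using h
  set K : ℝ := ‖U‖ + ‖V‖ + 1 with hK
  have hK0 : 0 < K := by positivity
  have hUK : ∀ x y, ‖U (delta p x) y‖ ≤ K := fun x y => by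
    have h2 := U.le_opNorm (delta p x)
    rw [norm_delta, mul_one] at h2
    linarith [norm_coe_le (U (delta p x)) y, norm_nonneg V]
  have hVK : ∀ x y, ‖V (delta p y) x‖ ≤ K := fun x y => by
    have h2 := V.le_opNorm (delta p y)
    rw [norm_delta, mul_one] at h2
    linarith [norm_coe_le (V (delta p y)) x, norm_nonneg U]
  have hUf : ∀ x, δ / K ≤ ‖U (delta p x) (f x)‖ := fun x => by
    rw [div_le_iff₀ hK0]
    refine (hfg x).trans ?_
    rw [norm_mul]
    exact mul_le_mul_of_nonneg_left (hVK _ _) (norm_nonneg _)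
  have hVg : ∀ x, δ / K ≤ ‖V (delta p (g x)) x‖ := fun x => by
    rw [div_le_iff₀ hK0, mul_comm]
    refine (hfg x).trans ?_
    rw [norm_mul]
    exact mul_le_mul_of_nonneg_right (hUK _ _) (norm_nonneg _)
  have hε : 0 < δ / K * (δ / K) := by positivity
  have hUVge : ∀ x x', δ / K * (δ / K) ≤ ‖U (delta p x) (f x) * V (delta p (g x')) x'‖ :=
    fun x x' => by
      rw [norm_mul]
      exact mul_le_mul (hUf x) (hVg x') (by positivity) (norm_nonneg _)
  have hspread : ∀ r : ℝ, ∃ k : ℕ, ∀ x x', dist x x' ≤ r → dist (g x') (f x) ≤ k := fun r => by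
    obtain ⟨k, hk⟩ := exists_dist_le_of_le_norm_entry_mul hX hUV r hε
    exact ⟨k, fun x x' hx => hk x x' hx _ _ (hUVge x x')⟩
  -- The case `r = 0` keeps `f` and `g` uniformly close.
  obtain ⟨k₀, hk₀⟩ := hspread 0
  refine ⟨f, fun r _ => ?_, fun s _ => ?_⟩
  · obtain ⟨k, hk⟩ := hspread r
    refine ⟨k + k₀ + 1, by positivity, fun x x' hx => ?_⟩
    have h1 := hk x x' hx.le
    have h2 := hk₀ x' x' (dist_self x').le
    rw [dist_comm] at h1
    linarith [dist_triangle (f x) (g x') (f x')]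
  -- With roles exchanged, the same products are entries of `V e U`, for `e` the matrix unit from `f
  -- x'` to `g x`.
  · obtain ⟨k, hk⟩ := exists_dist_le_of_le_norm_entry_mul hY hVU (s + k₀) hε
    refine ⟨k + 1, by positivity, fun x x' hx => ?_⟩
    by_contra! hle
    have h1 : dist (g x) (f x') ≤ s + k₀ := by
      linarith [dist_triangle (g x) (f x) (f x'), hk₀ x x (dist_self x).le]
    have h2 := hk (g x) (f x') h1 x x' ((hUVge x' x).trans_eq (by rw [mul_comm]))
    rw [dist_comm] at h2
    linarith

end UniformRoe

/-- Let `1 ≤ p < ∞` and let `X`, `Y` be uniformly locally finite metric spaces such that all ghost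
idempotents of the `ℓ_p` uniform Roe algebra of `Y` are compact. If the `ℓ_p` uniform Roe algebra of
`X` embeds isomorphically onto a hereditary Banach (that is, closed) subalgebra of that of `Y`, then
`X` coarsely embeds into `Y`. -/
theorem theorem1p2 (p : ℝ≥0∞) [Fact (1 ≤ p)] [Fact (p ≠ ∞)]
    {X Y : Type*} [MetricSpace X] [MetricSpace Y]
    (hX : UniformRoe.UniformlyLocallyFinite X) (hY : UniformRoe.UniformlyLocallyFinite Y)
    (hghost : ∀ P : UniformRoe.roeAlgebra p Y, IsIdempotentElem P →
      UniformRoe.IsGhost (P : UniformRoe.Ell p Y →L[ℂ] UniformRoe.Ell p Y) →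
      IsCompactOperator (P : UniformRoe.Ell p Y →L[ℂ] UniformRoe.Ell p Y))
    (hemb : ∃ (B : NonUnitalSubalgebra ℂ (UniformRoe.roeAlgebra p Y))
      (Φ : UniformRoe.roeAlgebra p X →ₙₐ[ℂ] UniformRoe.roeAlgebra p Y),
      IsClosed (B : Set (UniformRoe.roeAlgebra p Y)) ∧ UniformRoe.IsHereditary B ∧
      UniformRoe.IsIsomorphicEmbedding Φ ∧
      Set.range Φ = (B : Set (UniformRoe.roeAlgebra p Y))) :
    ∃ f : X → Y, UniformRoe.IsCoarseEmbedding f := by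
  rcases isEmpty_or_nonempty X with hempty | hne
  · exact ⟨fun x => hempty.elim x, fun _ _ => ⟨1, one_pos, fun x => hempty.elim x⟩,
      fun _ _ => ⟨1, one_pos, fun x => hempty.elim x⟩⟩
  obtain ⟨B, Φ, -, hB, hΦ, hrange⟩ := hemb
  obtain ⟨U, V, hid, hUV, hVU⟩ := UniformRoe.exists_spatial_implementation B Φ hB hΦ hrange
  obtain ⟨δ, hδ, h⟩ := UniformRoe.exists_forall_exists_le_norm_entry_mul hghost hid hUV
  exact UniformRoe.exists_isCoarseEmbedding hX hY hUV hVU hδ h
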